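/- Let $(\Omega,\mathcal F,\mathbb P)$ be a probability space, $\alpha>0$, $X_{0-}$ a real-valued random variable and $Z=(Z_t)_{t\ge 0}$ a real-valued process with continuous paths, $Z_0=0$, independent of $X_{0-}$. Assume that $Z$ has the crossing property: for every stopping time $\tau$ (with values in $[0,\infty]$) of the natural filtration of $X_{0-}+Z$ and every $h>0$, $$\mathbb P\Big(\tau<\infty,\ \inf_{0\le s\le h}(Z_{\tau+s}-Z_\tau)=0\Big)=0 .$$ A solution of the McKean–Vlasov problem is a triple $(X,\tau,\Lambda)$, where $\tau$ is a $[0,\infty]$-valued random variable, with $$X_t=X_{0-}+Z_t-\Lambda_t,\qquad \tau=\inf\{t\ge 0: X_t\le 0\},\qquad \Lambda_t=\alpha\,\mathbb P(\tau\le t),\qquad t\ge 0,$$ where $\inf\emptyset=\infty$. A solution $(\underline X,\underline\tau,\underline\Lambda)$ is minimal if $\underline\Lambda_t\le\Lambda_t$ for all $t\ge 0$ and every solution $(X,\tau,\Lambda)$. Let $M$ be the set of càdlàg increasing functions $\ell:[-\infty,\infty]\to[0,1]$ with $\ell_{0-}=0$ and $\ell_\infty=1$; say that $\ell^n\to\ell$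 in $M$ if $\ell^n_t\to\ell_t$ for every $t\in[0,\infty]$ at which $\ell$ is continuous. Denote by $0\in M$ the function equal to $0$ on $[-\infty,\infty)$ and to $1$ at $\infty$. For $\ell\in M$ put $X_t[\ell]=X_{0-}+Z_t-\alpha\ell_t$ for $t\ge0$, $\tau[\ell]=\inf\{t\ge 0:X_t[\ell]\le 0\}$ and $\Gamma[\ell]_t=\mathbb P(\tau[\ell]\le t)$ for $t\in[-\infty,\infty]$; this defines an operator $\Gamma:M\to M$, whose $k$-th iterate is denoted by $\Gamma^{(k)}$. Then there is a unique minimal solution $(\underline X,\underline\tau,\underline\Lambda)$ of the McKean–Vlasov problem, and it is given by $$\underline\Lambda=\alpha\lim_{k\to\infty}\Gamma^{(k)}[0],$$ in the sense that $\Gamma^{(k)}[0]\to\alpha^{-1}\underline\Lambda$ in $M$, where $\alpha^{-1}\underline\Lambda$ is regarded as an element of $M$ by giving it the value $0$ on $[-\infty,0)$ and the value $1$ at $\infty$. -/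

import Mathlib

open MeasureTheory ProbabilityTheory Filter Topology Set
open scoped NNReal ENNReal

noncomputable section

namespace McKeanVlasov

/-- The space `M` of cumulative distribution functions on `[0, ∞]`: càdlàg increasing functions
`ℓ : [-∞, ∞] → [0, 1]` with `ℓ_{0-} = 0` and `ℓ_∞ = 1`. (Left limits of an increasing function
exist automatically.) -/
structure M where
  /-- the underlying function on the two-point compactification of the real line -/
  toFun : EReal → ℝ
  mem_Icc' : ∀ t, toFun t ∈ Icc (0 : ℝ) 1
  monotone' : Monotone toFun
  rightCont' : ∀ t, ContinuousWithinAt toFun (Ici t) t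
  leftLim_zero' : Tendsto toFun (𝓝[<] 0) (𝓝 0)
  map_top' : toFun ⊤ = 1

instance : CoeFun M (fun _ => EReal → ℝ) := ⟨M.toFun⟩

/-- Convergence `ℓⁿ → ℓ` of a sequence in `M`: pointwise convergence at every `t ∈ [0, ∞]` at which
`ℓ` is continuous (as a function on `[-∞, ∞]`; so `0` is a discontinuity as soon as `ℓ₀ > 0`). -/
def ConvergesInM (L : ℕ → M) (l : M) : Prop :=
  ∀ t : EReal, 0 ≤ t → ContinuousAt l t → Tendsto (fun n => L n t) atTop (𝓝 (l t))

/-- The element `0` of `M`: it vanishes at all times `t < ∞` (and is `1` at `∞`, as every element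
of `M`). -/
def zeroM : M where
  toFun t := if t = ⊤ then 1 else 0
  mem_Icc' t := by by_cases h : t = ⊤ <;> simp [h]
  monotone' s t hst := by
    by_cases hs : s = ⊤
    · subst hs
      simp [top_le_iff.mp hst]
    · by_cases ht : t = ⊤ <;> simp [hs, ht]
  rightCont' t := by
    by_cases ht : t = ⊤
    · subst ht
      simp
    · apply ContinuousAt.continuousWithinAt
      have h : (fun t : EReal => if t = ⊤ then (1 : ℝ) else 0) =ᶠ[𝓝 t] fun _ => 0 := by
        filter_upwards [isOpen_ne.mem_nhds ht] with s hs
        exact (if_neg hs)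
      exact continuousAt_const.congr h.symm
  leftLim_zero' := by
    apply tendsto_const_nhds.congr'
    filter_upwards [self_mem_nhdsWithin] with s hs
    simp [(lt_top_iff_ne_top.mp (lt_of_lt_of_le (mem_Iio.mp hs) le_top))]
  map_top' := by simp

/-- `inf {t ≥ 0 : x_t ≤ 0}`, with value `∞` if the set is empty. -/
def hitTime (x : ℝ≥0 → ℝ) : ℝ≥0∞ := ⨅ (t : ℝ≥0) (_ : x t ≤ 0), (t : ℝ≥0∞)

/-- The crossing property: `ℙ(τ < ∞, inf_{0 ≤ s ≤ h} (Z_{τ+s} - Z_τ) = 0) = 0` for every `h > 0` and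
every stopping time `τ` of the natural filtration of `X₀ + Z`. -/
def CrossingProperty {Ω : Type*} [MeasurableSpace Ω] (P : Measure Ω) {X₀ : Ω → ℝ} {Z : ℝ≥0 → Ω → ℝ}
    (hX₀ : Measurable X₀) (hZ : ∀ t, Measurable (Z t)) : Prop :=
  ∀ τ : Ω → WithTop ℝ≥0,
    IsStoppingTime (Filtration.natural (fun t ω => X₀ ω + Z t ω)
      (fun t => (hX₀.add (hZ t)).stronglyMeasurable)) τ →
    ∀ h : ℝ≥0, 0 < h →
      P {ω | ∃ t : ℝ≥0, τ ω = t ∧ sInf ((fun s => Z (t + s) ω - Z t ω) '' Icc 0 h) = 0} = 0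

/-- `(X, τ, Λ)` is a solution of the McKean-Vlasov problem with data `α`, `X₀`, `Z`. -/
structure IsSolution {Ω : Type*} [MeasurableSpace Ω] (P : Measure Ω) (α : ℝ)
    (X₀ : Ω → ℝ) (Z : ℝ≥0 → Ω → ℝ)
    (X : ℝ≥0 → Ω → ℝ) (τ : Ω → ℝ≥0∞) (Λ : ℝ≥0 → ℝ) : Prop where
  /-- `τ` is a random variable, so that `ℙ(τ ≤ t)` makes sense. -/
  measurable_tau : Measurable τ
  X_eq : ∀ t ω, X t ω = X₀ ω + Z t ω - Λ t
  tau_eq : ∀ ω, τ ω = hitTime (fun t => X t ω)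
  Lambda_eq : ∀ t : ℝ≥0, Λ t = α * P.real {ω | τ ω ≤ t}

/-- A solution is minimal if its `Λ` lies below the `Λ` of every solution. -/
def IsMinimalSolution {Ω : Type*} [MeasurableSpace Ω] (P : Measure Ω) (α : ℝ)
    (X₀ : Ω → ℝ) (Z : ℝ≥0 → Ω → ℝ)
    (X : ℝ≥0 → Ω → ℝ) (τ : Ω → ℝ≥0∞) (Λ : ℝ≥0 → ℝ) : Prop :=
  IsSolution P α X₀ Z X τ Λ ∧
    ∀ X' τ' Λ', IsSolution P α X₀ Z X' τ' Λ' → ∀ t, Λ t ≤ Λ' t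

/-- `X_t[ℓ] = X₀ + Z_t - α ℓ_t`. -/
def pathOf {Ω : Type*} (α : ℝ) (X₀ : Ω → ℝ) (Z : ℝ≥0 → Ω → ℝ) (l : M) (t : ℝ≥0) (ω : Ω) : ℝ :=
  X₀ ω + Z t ω - α * l ((t : ℝ) : EReal)

/-- `τ[ℓ] = inf {t ≥ 0 : X_t[ℓ] ≤ 0}`. -/
def tauOf {Ω : Type*} (α : ℝ) (X₀ : Ω → ℝ) (Z : ℝ≥0 → Ω → ℝ) (l : M) (ω : Ω) : ℝ≥0∞ :=
  hitTime (fun t => pathOf α X₀ Z l t ω)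

/-! Helper facts: `τ[ℓ]` is measurable, and `Γ[ℓ]` lies in `M`. -/

lemma hitTime_le_iff {x : ℝ≥0 → ℝ} (hx : LowerSemicontinuous x) (t : ℝ≥0) :
    hitTime x ≤ t ↔ ∃ s ≤ t, x s ≤ 0 := by
  constructor
  · intro h
    have hcl : IsClosed {s | x s ≤ 0} := hx.isClosed_preimage 0
    have hne : {s | x s ≤ 0}.Nonempty := by
      by_contra hemp
      rw [not_nonempty_iff_eq_empty] at hemp
      have : ∀ s, ¬ x s ≤ 0 := fun s hs => by
        have : s ∈ {s | x s ≤ 0} := hs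
        simp [hemp] at this
      simp [hitTime, this] at h
    refine ⟨sInf {s | x s ≤ 0}, ?_, hcl.csInf_mem hne (OrderBot.bddBelow _)⟩
    rw [← ENNReal.coe_le_coe]
    refine le_trans ?_ h
    refine le_iInf₂ fun s hs => ?_
    exact ENNReal.coe_le_coe.mpr (csInf_le (OrderBot.bddBelow _) hs)
  · rintro ⟨s, hst, hs⟩
    exact (iInf₂_le s hs).trans (ENNReal.coe_le_coe.mpr hst)

lemma continuous_coeReal : Continuous (fun t : ℝ≥0 => ((t : ℝ) : EReal)) :=
  continuous_coe_real_ereal.comp NNReal.continuous_coe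

lemma pathOf_rightCont {Ω : Type*} {α : ℝ} {X₀ : Ω → ℝ} {Z : ℝ≥0 → Ω → ℝ}
    (hZc : ∀ ω, Continuous fun t => Z t ω) (l : M) (ω : Ω) (t : ℝ≥0) :
    ContinuousWithinAt (fun s => pathOf α X₀ Z l s ω) (Ici t) t := by
  have h1 : ContinuousWithinAt (fun s : ℝ≥0 => l ((s : ℝ) : EReal)) (Ici t) t := by
    refine (l.rightCont' ((t : ℝ) : EReal)).comp (t := Ici ((t : ℝ) : EReal))
      continuous_coeReal.continuousWithinAt ?_
    intro s hs
    simpa using hs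
  exact ((continuous_const.add (hZc ω)).continuousWithinAt).sub (h1.const_mul α)

lemma pathOf_lsc {Ω : Type*} {α : ℝ} (hα : 0 < α) {X₀ : Ω → ℝ} {Z : ℝ≥0 → Ω → ℝ}
    (hZc : ∀ ω, Continuous fun t => Z t ω) (l : M) (ω : Ω) :
    LowerSemicontinuous (fun s => pathOf α X₀ Z l s ω) := by
  intro t y hy
  rw [← nhdsLT_sup_nhdsGE, eventually_sup]
  constructor
  · have hc : Continuous fun s : ℝ≥0 => X₀ ω + Z s ω - α * l ((t : ℝ) : EReal) :=
      (continuous_const.add (hZc ω)).sub continuous_const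
    have h2 : ∀ᶠ s in 𝓝[<] t, y < X₀ ω + Z s ω - α * l ((t : ℝ) : EReal) :=
      nhdsWithin_le_nhds (hc.continuousAt.eventually (lt_mem_nhds hy))
    filter_upwards [h2, self_mem_nhdsWithin] with s hs hst
    refine hs.trans_le ?_
    have : l ((s : ℝ) : EReal) ≤ l ((t : ℝ) : EReal) := by
      apply l.monotone'
      simpa using (mem_Iio.mp hst).le
    unfold pathOf
    gcongr
  · exact (pathOf_rightCont hZc l ω t).eventually (lt_mem_nhds hy)

lemma measurable_tauOf {Ω : Type*} [MeasurableSpace Ω] {α : ℝ} (hα : 0 < α) {X₀ : Ω → ℝ} {Z : ℝ≥0 → Ω → ℝ}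
    (hX₀ : Measurable X₀) (hZ : ∀ t, Measurable (Z t))
    (hZc : ∀ ω, Continuous fun t => Z t ω) (l : M) : Measurable (tauOf α X₀ Z l) := by
  apply measurable_of_Iic
  intro c
  induction c with
  | top => simp
  | coe t =>
    obtain ⟨D, hDc, hDd⟩ := TopologicalSpace.exists_countable_dense ℝ≥0
    have key : tauOf α X₀ Z l ⁻¹' Iic (t : ℝ≥0∞) =
        ⋂ n : ℕ, ⋃ q ∈ D, {ω | pathOf α X₀ Z l (min q t) ω < 1 / ((n : ℝ) + 1)} := by
      ext ω
      simp only [mem_preimage, mem_Iic, mem_iInter, mem_iUnion, mem_ofPred_eq, exists_prop]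
      rw [tauOf, hitTime_le_iff (pathOf_lsc hα hZc l ω)]
      constructor
      · rintro ⟨s, hst, hs⟩ n
        have hpos : pathOf α X₀ Z l s ω < 1 / ((n : ℝ) + 1) := hs.trans_lt (by positivity)
        have hev := (pathOf_rightCont (α := α) (X₀ := X₀) hZc l ω s).eventually
          (gt_mem_nhds hpos)
        rw [eventually_iff, mem_nhdsGE_iff_exists_Ico_subset] at hev
        obtain ⟨u, hu, hsub⟩ := hev
        obtain ⟨q, hq, hqD⟩ := hDd.exists_mem_open (isOpen_Ioo (a := s) (b := u))
          (nonempty_Ioo.mpr hu)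
        refine ⟨q, hq, hsub ⟨le_min hqD.1.le hst, (min_le_left _ _).trans_lt hqD.2⟩⟩
      · intro h
        obtain ⟨s, hs, hmin⟩ := (pathOf_lsc (X₀ := X₀) hα hZc l ω).lowerSemicontinuousOn
          (Icc 0 t) |>.exists_isMinOn (nonempty_Icc.mpr (zero_le)) isCompact_Icc
        refine ⟨s, hs.2, ?_⟩
        refine le_of_forall_pos_lt_add fun ε hε => ?_
        obtain ⟨n, hn⟩ := exists_nat_one_div_lt hε
        obtain ⟨q, -, hq⟩ := h n
        have := hmin (show min q t ∈ Icc 0 t from ⟨zero_le, min_le_right _ _⟩)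
        simp only [mem_ofPred_eq] at this
        linarith
    rw [key]
    refine MeasurableSet.iInter fun n => MeasurableSet.biUnion hDc fun q _ => ?_
    exact measurableSet_lt ((hX₀.add (hZ _)).sub measurable_const) measurable_const

/-- The fixed-point operator `Γ : M → M`, `Γ[ℓ]_t = ℙ(τ[ℓ] ≤ t)`. -/
def Gamma {Ω : Type*} [MeasurableSpace Ω] (P : Measure Ω) [IsProbabilityMeasure P]
    {α : ℝ} (hα : 0 < α) {X₀ : Ω → ℝ}
    {Z : ℝ≥0 → Ω → ℝ} (hX₀ : Measurable X₀) (hZ : ∀ t, Measurable (Z t))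
    (hZc : ∀ ω, Continuous fun t => Z t ω) (l : M) : M where
  toFun t := P.real {ω | (tauOf α X₀ Z l ω : EReal) ≤ t}
  mem_Icc' t := ⟨measureReal_nonneg, measureReal_le_one⟩
  monotone' s t hst := measureReal_mono (fun ω (hω : (tauOf α X₀ Z l ω : EReal) ≤ s) => hω.trans hst)
  rightCont' t := by
    have hm : Measurable fun ω => (tauOf α X₀ Z l ω : EReal) :=
      measurable_coe_ennreal_ereal.comp (measurable_tauOf hα hX₀ hZ hZc l)
    by_cases ht : t = ⊤
    · subst ht
      simp
    · rw [← continuousWithinAt_Ioi_iff_Ici]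
      have h := tendsto_measure_biInter_gt (μ := P)
        (s := fun r : EReal => {ω | (tauOf α X₀ Z l ω : EReal) ≤ r}) (a := t)
        (fun r _ => (measurableSet_le hm measurable_const).nullMeasurableSet)
        (fun i j _ hij ω (hω : (tauOf α X₀ Z l ω : EReal) ≤ i) => hω.trans hij)
        ⟨⊤, lt_top_iff_ne_top.mpr ht, measure_ne_top _ _⟩
      have he : (⋂ r > t, {ω | (tauOf α X₀ Z l ω : EReal) ≤ r}) =
          {ω | (tauOf α X₀ Z l ω : EReal) ≤ t} := by
        ext ω
        simp only [mem_iInter, mem_ofPred_eq]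
        exact ⟨fun h => le_of_forall_gt_imp_ge_of_dense h, fun h r hr => h.trans hr.le⟩
      rw [he] at h
      exact (ENNReal.tendsto_toReal (measure_ne_top _ _)).comp h
  leftLim_zero' := by
    apply tendsto_const_nhds.congr'
    filter_upwards [self_mem_nhdsWithin] with t ht
    have : {ω | (tauOf α X₀ Z l ω : EReal) ≤ t} = ∅ := by
      ext ω
      simp only [mem_ofPred_eq, mem_empty_iff_false, iff_false, not_le]
      exact lt_of_lt_of_le ht (EReal.coe_ennreal_nonneg _)
    simp [this]
  map_top' := by simp

end McKeanVlasov

end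

/-! A larger `l` lowers the path, so it is hit earlier and `Gamma` is monotone. Hence the iterates
from `zeroM` increase, and by induction they stay below `P(τ ≤ ·)` for every solution. Let ℓ be the
right-continuous version of their supremum; at continuity points of ℓ the iterates converge to it,
and right continuity keeps ℓ below every solution. It remains to see that ℓ is a fixed point on
finite times.

Monotonicity gives ℓ ≤ Γ[ℓ] (`picardLimit_le_Gamma`). The reverse inequality
(`Gamma_le_picardLimit`) is where crossing enters: almost surely `Z` drops strictly just after τ[ℓ],
so the limiting path becomes strictly negative, and then some iterate's path has been hit shortly
after τ[ℓ] (`ae_exists_tauOf_le`). -/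

namespace McKeanVlasov

/-! ### Suprema and limits of increasing sequences in `M`. -/

section IncreasingLimit

lemma M.bddAbove_range (L : ℕ → M) (t : EReal) : BddAbove (range fun k => L k t) :=
  ⟨1, by rintro _ ⟨k, rfl⟩; exact ((L k).mem_Icc' t).2⟩

lemma M.apply_eq_zero_of_neg (l : M) {t : EReal} (ht : t < 0) : l t = 0 := by
  refine le_antisymm ?_ (l.mem_Icc' t).1
  have : (𝓝[<] (0 : EReal)).NeBot := nhdsLT_neBot_of_exists_lt ⟨t, ht⟩
  refine ge_of_tendsto l.leftLim_zero' ?_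
  filter_upwards [Ioo_mem_nhdsLT ht] with s hs using l.monotone' hs.1.le

lemma zeroM_apply_of_ne_top {t : EReal} (ht : t ≠ ⊤) : zeroM t = 0 := if_neg ht

lemma zeroM_le (l : M) (t : EReal) : zeroM t ≤ l t := by
  by_cases ht : t = ⊤
  · subst ht
    rw [zeroM.map_top', l.map_top']
  · rw [zeroM_apply_of_ne_top ht]
    exact (l.mem_Icc' t).1

lemma M.monotone_iSup (L : ℕ → M) : Monotone fun t : EReal => ⨆ k, L k t := fun _ t hst =>
  ciSup_mono (M.bddAbove_range L t) fun k => (L k).monotone' hst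

/-- The right-continuous version of the pointwise supremum of a sequence in `M`. -/
noncomputable def M.regularizedSup (L : ℕ → M) : M where
  toFun := Function.rightLim fun t : EReal => ⨆ k, L k t
  mem_Icc' t := by
    constructor
    · refine le_trans ?_ ((M.monotone_iSup L).le_rightLim le_rfl)
      exact Real.iSup_nonneg fun k => ((L k).mem_Icc' t).1
    · refine ((M.monotone_iSup L).rightLim le_top).trans ?_
      rw [rightLim_eq_of_isTop isTop_top]
      exact ciSup_le fun k => ((L k).mem_Icc' ⊤).2
  monotone' := (M.monotone_iSup L).rightLim
  rightCont' t := continuousWithinAt_rightLim_Ici ((M.monotone_iSup L).tendsto_rightLim t)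
  leftLim_zero' := by
    apply tendsto_const_nhds.congr'
    filter_upwards [self_mem_nhdsWithin] with t (ht : t < 0)
    obtain ⟨s, hts, hs⟩ := exists_between ht
    refine le_antisymm ?_ ?_
    · refine le_trans ?_ ((M.monotone_iSup L).le_rightLim le_rfl)
      exact Real.iSup_nonneg fun k => ((L k).mem_Icc' t).1
    · refine ((M.monotone_iSup L).rightLim_le hts).trans ?_
      simp [fun k => (L k).apply_eq_zero_of_neg hs]
  map_top' := by
    rw [rightLim_eq_of_isTop isTop_top]
    simp [fun k => (L k).map_top']

lemma M.le_regularizedSup (L : ℕ → M) (k : ℕ) (t : EReal) : L k t ≤ M.regularizedSup L t :=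
  (le_ciSup (M.bddAbove_range L t) k).trans ((M.monotone_iSup L).le_rightLim le_rfl)

lemma M.regularizedSup_le_iSup (L : ℕ → M) {s t : EReal} (hst : s < t) :
    M.regularizedSup L s ≤ ⨆ k, L k t :=
  (M.monotone_iSup L).rightLim_le hst

lemma M.regularizedSup_le (L : ℕ → M) {l : M} (h : ∀ k t, L k t ≤ l t) (t : EReal) :
    M.regularizedSup L t ≤ l t := by
  by_cases ht : t = ⊤
  · subst ht
    rw [l.map_top', M.map_top']
  · have : (𝓝[>] t).NeBot := nhdsGT_neBot_of_exists_gt ⟨⊤, lt_top_iff_ne_top.mpr ht⟩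
    refine ge_of_tendsto ((l.rightCont' t).mono Ioi_subset_Ici_self) ?_
    filter_upwards [self_mem_nhdsWithin] with s hs
    exact (M.regularizedSup_le_iSup L hs).trans (ciSup_le fun k => h k s)

lemma M.le_regularizedSup_of_forall_gt (L : ℕ → M) {t : ℝ≥0} {c : ℝ}
    (h : ∀ s : ℝ≥0, t < s → c ≤ ⨆ k, L k ((s : ℝ) : EReal)) :
    c ≤ M.regularizedSup L ((t : ℝ) : EReal) := by
  have : (𝓝[>] ((t : ℝ) : EReal)).NeBot := nhdsGT_neBot_of_exists_gt ⟨⊤, EReal.coe_lt_top _⟩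
  refine ge_of_tendsto ((M.monotone_iSup L).tendsto_rightLim ((t : ℝ) : EReal)) ?_
  filter_upwards [self_mem_nhdsWithin] with s hs
  obtain ⟨r, hr, hrs⟩ := EReal.lt_iff_exists_real_btwn.mp hs
  have htr : (t : ℝ) < r := EReal.coe_lt_coe_iff.mp hr
  lift r to ℝ≥0 using t.coe_nonneg.trans htr.le
  exact (h r (NNReal.coe_lt_coe.mp htr)).trans (M.monotone_iSup L hrs.le)

/-- For s < t the supremum at t lies between the regularized values at s and at t; let s increase to
a continuity point t. -/
lemma M.convergesInM_regularizedSup (L : ℕ → M) (hL : ∀ t, Monotone fun k => L k t) :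
    ConvergesInM L (M.regularizedSup L) := by
  intro t ht hc
  have hlim := tendsto_atTop_ciSup (hL t) (M.bddAbove_range L t)
  suffices (⨆ k, L k t) = M.regularizedSup L t by rwa [this] at hlim
  refine le_antisymm (ciSup_le fun k => M.le_regularizedSup L k t) ?_
  -- Since time starts at `⊥`, even t = 0 has left neighbours.
  have : (𝓝[<] t).NeBot := nhdsLT_neBot_of_exists_lt ⟨⊥, lt_of_lt_of_le EReal.bot_lt_zero ht⟩
  refine le_of_tendsto (hc.tendsto.mono_left nhdsWithin_le_nhds : Tendsto _ (𝓝[<] t) _) ?_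
  filter_upwards [self_mem_nhdsWithin] with s hs using M.regularizedSup_le_iSup L hs

end IncreasingLimit

/-! ### Hitting times and their distribution functions. -/

lemma hitTime_le {x : ℝ≥0 → ℝ} {t : ℝ≥0} (h : x t ≤ 0) : hitTime x ≤ t := iInf₂_le t h

lemma hitTime_mono {x y : ℝ≥0 → ℝ} (h : ∀ t, x t ≤ y t) : hitTime x ≤ hitTime y :=
  le_iInf₂ fun t ht => hitTime_le ((h t).trans ht)

lemma apply_hitTime_le {x : ℝ≥0 → ℝ} (hx : LowerSemicontinuous x) {t : ℝ≥0}
    (ht : hitTime x = t) : x t ≤ 0 := by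
  obtain ⟨s, hst, hs⟩ := (hitTime_le_iff hx t).mp ht.le
  have hts : t ≤ s := by
    have := hitTime_le hs
    rwa [ht, ENNReal.coe_le_coe] at this
  rwa [le_antisymm hts hst]

/-- Right continuity of a distribution function, for the `τ` of an arbitrary solution, which is not
presented as a `tauOf`. -/
lemma le_measureReal_of_forall_gt {Ω : Type*} [MeasurableSpace Ω] (P : Measure Ω)
    [IsProbabilityMeasure P] {τ : Ω → ℝ≥0∞} (hτ : Measurable τ) {t : ℝ≥0} {c : ℝ}
    (h : ∀ s : ℝ≥0, t < s → c ≤ P.real {ω | τ ω ≤ s}) : c ≤ P.real {ω | τ ω ≤ t} := by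
  have hlim := tendsto_measure_biInter_gt (μ := P) (s := fun r : ℝ≥0 => {ω | τ ω ≤ r}) (a := t)
    (fun r _ => (measurableSet_le hτ measurable_const).nullMeasurableSet)
    (fun i j _ hij ω (hω : τ ω ≤ i) => hω.trans (ENNReal.coe_le_coe.mpr hij))
    ⟨t + 1, lt_add_one t, measure_ne_top _ _⟩
  have hset : (⋂ r > t, {ω | τ ω ≤ (r : ℝ≥0∞)}) = {ω | τ ω ≤ t} := by
    ext ω
    simp only [mem_iInter, mem_ofPred_eq]
    constructor
    · intro hω
      refine le_of_forall_gt_imp_ge_of_dense fun r hr => ?_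
      induction r with
      | top => exact le_top
      | coe r => exact hω r (ENNReal.coe_lt_coe.mp hr)
    · exact fun hω r hr => hω.trans (ENNReal.coe_le_coe.mpr hr.le)
  rw [hset] at hlim
  refine ge_of_tendsto ((ENNReal.tendsto_toReal (measure_ne_top _ _)).comp hlim) ?_
  filter_upwards [self_mem_nhdsWithin] with s hs using h s hs

/-! ### Crossing and stability of hitting times. -/

section PicardIteration

variable {Ω : Type*} {α : ℝ} {X₀ : Ω → ℝ} {Z : ℝ≥0 → Ω → ℝ}

lemma tauOf_anti (hα : 0 < α) {l l' : M} (h : ∀ t, l t ≤ l' t) (ω : Ω) :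
    tauOf α X₀ Z l' ω ≤ tauOf α X₀ Z l ω :=
  hitTime_mono fun _ => sub_le_sub_left (mul_le_mul_of_nonneg_left (h _) hα.le) _

variable [MeasurableSpace Ω]

/-- Whether the path is hit by time t depends only on the process up to t, so freeze it at t and
apply `measurable_tauOf` over the σ-algebra `ℱ t`. The filtration sees only the sum `X₀ + Z`, so
`X₀` is absorbed into the process and replaced by 0. -/
lemma isStoppingTime_tauOf (hα : 0 < α) (hX₀ : Measurable X₀) (hZ : ∀ t, Measurable (Z t))
    (hZc : ∀ ω, Continuous fun t => Z t ω) (l : M) :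
    IsStoppingTime (Filtration.natural (fun t ω => X₀ ω + Z t ω)
      (fun t => (hX₀.add (hZ t)).stronglyMeasurable)) (tauOf α X₀ Z l) := by
  intro t
  set ℱ := Filtration.natural (fun t ω => X₀ ω + Z t ω)
      (fun t => (hX₀.add (hZ t)).stronglyMeasurable)
  have hfrozen : ∀ s, Measurable[ℱ t] fun ω => X₀ ω + Z (min s t) ω := fun s =>
    measurable_iff_comap_le.mpr
      (le_iSup₂_of_le (f := fun j (_ : j ≤ t) =>
        MeasurableSpace.comap (fun ω => X₀ ω + Z j ω) inferInstance) (min s t)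
        (min_le_right _ _) le_rfl)
  have hc : ∀ ω, Continuous fun s => X₀ ω + Z (min s t) ω := fun ω =>
    continuous_const.add ((hZc ω).comp (continuous_id.min continuous_const))
  have hmeas : Measurable[ℱ t] (tauOf α (fun _ => 0) (fun s ω => X₀ ω + Z (min s t) ω) l) :=
    @measurable_tauOf Ω (ℱ t) α hα _ _ (@measurable_const _ _ _ (ℱ t) 0) hfrozen hc l
  have hset : {ω | tauOf α X₀ Z l ω ≤ t} =
      tauOf α (fun _ => 0) (fun s ω => X₀ ω + Z (min s t) ω) l ⁻¹' Iic (t : ℝ≥0∞) := by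
    ext ω
    simp only [mem_ofPred_eq, mem_preimage, mem_Iic, tauOf]
    rw [hitTime_le_iff (pathOf_lsc hα hZc l ω), hitTime_le_iff (pathOf_lsc hα hc l ω)]
    refine exists_congr fun s => and_congr_right fun hs => ?_
    simp [pathOf, min_eq_left hs]
  exact hset ▸ hmeas measurableSet_Iic

/-- Almost surely, `Z` falls strictly below `Z_τ[ℓ]` immediately after the time `τ[ℓ]`. -/
lemma ae_exists_lt_after_tauOf {P : Measure Ω} (hα : 0 < α) (hX₀ : Measurable X₀)
    (hZ : ∀ t, Measurable (Z t)) (hZc : ∀ ω, Continuous fun t => Z t ω)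
    (hcross : CrossingProperty P hX₀ hZ) (l : M) :
    ∀ᵐ ω ∂P, ∀ t : ℝ≥0, tauOf α X₀ Z l ω = t → ∀ h : ℝ≥0, 0 < h →
      ∃ s ≤ h, Z (t + s) ω < Z t ω := by
  have hn : ∀ n : ℕ, ∀ᵐ ω ∂P, ∀ t : ℝ≥0, tauOf α X₀ Z l ω = t →
      ∃ s ≤ 1 / ((n : ℝ≥0) + 1), Z (t + s) ω < Z t ω := by
    intro n
    rw [ae_iff]
    refine measure_mono_null ?_
      (hcross _ (isStoppingTime_tauOf hα hX₀ hZ hZc l) (1 / ((n : ℝ≥0) + 1)) (by positivity))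
    intro ω hω
    simp only [mem_ofPred_eq] at hω
    push Not at hω
    obtain ⟨t, ht, hmin⟩ := hω
    -- Without a strict drop, the infimum of the increments is 0, attained at s = 0.
    refine ⟨t, ht, IsLeast.csInf_eq ⟨⟨0, ⟨le_rfl, zero_le⟩, by simp⟩, ?_⟩⟩
    rintro _ ⟨s, hs, rfl⟩
    exact sub_nonneg.mpr (hmin s hs.2)
  filter_upwards [ae_all_iff.mpr hn] with ω hω t ht h hh
  obtain ⟨n, hn⟩ := exists_nat_one_div_lt hh
  obtain ⟨s, hs, hlt⟩ := hω n t ht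
  exact ⟨s, hs.trans hn.le, hlt⟩

/-- An arbitrarily small delay t < s suffices: the strict drop of `Z` after the limiting hitting
time leaves room to replace the supremum by a single `L k`. -/
lemma ae_exists_tauOf_le {P : Measure Ω} (hα : 0 < α) (hX₀ : Measurable X₀)
    (hZ : ∀ t, Measurable (Z t)) (hZc : ∀ ω, Continuous fun t => Z t ω)
    (hcross : CrossingProperty P hX₀ hZ) (L : ℕ → M) :
    ∀ᵐ ω ∂P, ∀ t s : ℝ≥0, t < s → tauOf α X₀ Z (M.regularizedSup L) ω ≤ t →
      ∃ k, tauOf α X₀ Z (L k) ω ≤ s := by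
  filter_upwards [ae_exists_lt_after_tauOf hα hX₀ hZ hZc hcross (M.regularizedSup L)]
    with ω hω t s hts hτt
  obtain ⟨t₀, ht₀⟩ : ∃ t₀ : ℝ≥0, (t₀ : ℝ≥0∞) = tauOf α X₀ Z (M.regularizedSup L) ω :=
    ⟨_, ENNReal.coe_toNNReal (ne_top_of_le_ne_top ENNReal.coe_ne_top hτt)⟩
  have ht₀t : t₀ ≤ t := by rwa [← ht₀, ENNReal.coe_le_coe] at hτt
  have hhit := apply_hitTime_le (pathOf_lsc hα hZc (M.regularizedSup L) ω) ht₀.symm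
  obtain ⟨h, hh, hhs⟩ := exists_between (tsub_pos_of_lt (ht₀t.trans_lt hts))
  obtain ⟨r, hr, hZr⟩ := hω t₀ ht₀.symm h hh
  have hv : t₀ + r < s := lt_tsub_iff_left.mp (hr.trans_lt hhs)
  have hneg : X₀ ω + Z (t₀ + r) ω - α * M.regularizedSup L (((t₀ + r : ℝ≥0) : ℝ) : EReal) < 0 := by
    have hle : α * M.regularizedSup L ((t₀ : ℝ) : EReal) ≤
        α * M.regularizedSup L (((t₀ + r : ℝ≥0) : ℝ) : EReal) := by
      refine mul_le_mul_of_nonneg_left ((M.regularizedSup L).monotone' ?_) hα.le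
      exact EReal.coe_le_coe_iff.mpr (NNReal.coe_le_coe.mpr le_self_add)
    unfold pathOf at hhit
    linarith
  have hcont : Continuous fun u : ℝ≥0 =>
      X₀ ω + Z u ω - α * M.regularizedSup L (((t₀ + r : ℝ≥0) : ℝ) : EReal) :=
    (continuous_const.add (hZc ω)).sub continuous_const
  -- The regularized value at `t₀ + r` is bounded by the plain supremum only at strictly later
  -- times, so move on to some u > `t₀ + r`, keeping negativity by continuity of `Z`.
  have : (𝓝[>] (t₀ + r)).NeBot := nhdsGT_neBot_of_exists_gt ⟨s, hv⟩
  have hev := (hcont.continuousAt.eventually (gt_mem_nhds hneg)).filter_mono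
    (nhdsWithin_le_nhds (s := Ioi (t₀ + r)))
  obtain ⟨u, hu, huI⟩ := (hev.and (Ioo_mem_nhdsGT hv)).exists
  have hsup := M.regularizedSup_le_iSup L
    (EReal.coe_lt_coe_iff.mpr (NNReal.coe_lt_coe.mpr huI.1))
  have hlt : (X₀ ω + Z u ω) / α < ⨆ k, L k ((u : ℝ) : EReal) := by
    refine lt_of_lt_of_le ?_ hsup
    rw [div_lt_iff₀' hα]
    linarith
  obtain ⟨k, hk⟩ := exists_lt_of_lt_ciSup hlt
  rw [div_lt_iff₀' hα] at hk
  refine ⟨k, (hitTime_le (t := u) ?_).trans (ENNReal.coe_le_coe.mpr huI.2.le)⟩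
  unfold pathOf
  linarith

/-! ### The Picard limit: fixed point and minimality. -/

variable (P : Measure Ω) [IsProbabilityMeasure P] (hα : 0 < α) (hX₀ : Measurable X₀)
  (hZ : ∀ t, Measurable (Z t)) (hZc : ∀ ω, Continuous fun t => Z t ω)

lemma Gamma_apply_coe (l : M) (t : ℝ≥0) :
    Gamma P hα hX₀ hZ hZc l ((t : ℝ) : EReal) = P.real {ω | tauOf α X₀ Z l ω ≤ t} := by
  change P.real {ω | (tauOf α X₀ Z l ω : EReal) ≤ ((t : ℝ) : EReal)} = _
  congr 1
  ext ω
  have : ((t : ℝ) : EReal) = ((t : ℝ≥0∞) : EReal) := rfl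
  simp only [mem_ofPred_eq]
  rw [this, EReal.coe_ennreal_le_coe_ennreal_iff]

lemma Gamma_mono {l l' : M} (h : ∀ t, l t ≤ l' t) (t : EReal) :
    Gamma P hα hX₀ hZ hZc l t ≤ Gamma P hα hX₀ hZ hZc l' t :=
  measureReal_mono fun ω (hω : (tauOf α X₀ Z l ω : EReal) ≤ t) =>
    (EReal.coe_ennreal_le_coe_ennreal_iff.mpr (tauOf_anti hα h ω)).trans hω

/-- The Picard iteration `Γ⁽ᵏ⁾[0]`. -/
noncomputable def picard (k : ℕ) : M := (Gamma P hα hX₀ hZ hZc)^[k] zeroM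

lemma picard_succ (k : ℕ) :
    picard P hα hX₀ hZ hZc (k + 1) = Gamma P hα hX₀ hZ hZc (picard P hα hX₀ hZ hZc k) :=
  Function.iterate_succ_apply' _ _ _

lemma picard_le_succ (k : ℕ) (t : EReal) :
    picard P hα hX₀ hZ hZc k t ≤ picard P hα hX₀ hZ hZc (k + 1) t := by
  induction k generalizing t with
  | zero => exact zeroM_le _ t
  | succ k ih =>
    rw [picard_succ, picard_succ P hα hX₀ hZ hZc (k + 1)]
    exact Gamma_mono P hα hX₀ hZ hZc ih t

lemma picard_monotone (t : EReal) : Monotone fun k => picard P hα hX₀ hZ hZc k t :=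
  monotone_nat_of_le_succ fun k => picard_le_succ P hα hX₀ hZ hZc k t

/-- The limit in `M` of the Picard iteration. -/
noncomputable def picardLimit : M := M.regularizedSup (picard P hα hX₀ hZ hZc)

lemma picardLimit_le_Gamma (t : EReal) :
    picardLimit P hα hX₀ hZ hZc t ≤ Gamma P hα hX₀ hZ hZc (picardLimit P hα hX₀ hZ hZc) t := by
  refine M.regularizedSup_le _ (fun k s => ?_) t
  cases k with
  | zero => exact zeroM_le _ s
  | succ k =>
    rw [picard_succ]
    exact Gamma_mono P hα hX₀ hZ hZc (M.le_regularizedSup _ k) s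

lemma Gamma_le_picardLimit (hcross : CrossingProperty P hX₀ hZ) (t : ℝ≥0) :
    P.real {ω | tauOf α X₀ Z (picardLimit P hα hX₀ hZ hZc) ω ≤ t} ≤
      picardLimit P hα hX₀ hZ hZc ((t : ℝ) : EReal) := by
  refine M.le_regularizedSup_of_forall_gt _ fun s hts => ?_
  set L := picard P hα hX₀ hZ hZc
  have hmono : Monotone fun k => {ω | tauOf α X₀ Z (L k) ω ≤ s} :=
    monotone_nat_of_le_succ fun k ω hω =>
      (tauOf_anti hα (picard_le_succ P hα hX₀ hZ hZc k) ω).trans hω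
  have hle : P {ω | tauOf α X₀ Z (picardLimit P hα hX₀ hZ hZc) ω ≤ t} ≤
      P (⋃ k, {ω | tauOf α X₀ Z (L k) ω ≤ s}) := by
    refine measure_mono_ae ?_
    filter_upwards [ae_exists_tauOf_le hα hX₀ hZ hZc hcross L] with ω hω h
    exact mem_iUnion.mpr (hω t s hts h)
  refine (ENNReal.toReal_mono (measure_ne_top _ _) hle).trans ?_
  refine le_of_tendsto ((ENNReal.tendsto_toReal (measure_ne_top _ _)).comp
    (tendsto_measure_iUnion_atTop hmono)) (Eventually.of_forall fun k => ?_)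
  -- `Gamma` shifts the iteration: the law of the k-th hitting time is iterate k + 1.
  refine le_trans (le_of_eq ?_) (le_ciSup (M.bddAbove_range L _) (k + 1))
  change P.real _ = picard P hα hX₀ hZ hZc (k + 1) _
  rw [picard_succ, Gamma_apply_coe]

lemma picardLimit_eq (hcross : CrossingProperty P hX₀ hZ) (t : ℝ≥0) :
    picardLimit P hα hX₀ hZ hZc ((t : ℝ) : EReal) =
      P.real {ω | tauOf α X₀ Z (picardLimit P hα hX₀ hZ hZc) ω ≤ t} :=
  le_antisymm
    ((picardLimit_le_Gamma P hα hX₀ hZ hZc _).trans_eq (Gamma_apply_coe P hα hX₀ hZ hZc _ t))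
    (Gamma_le_picardLimit P hα hX₀ hZ hZc hcross t)

variable {X : ℝ≥0 → Ω → ℝ} {τ : Ω → ℝ≥0∞} {Λ : ℝ≥0 → ℝ}

/-- If an iterate is below the solution's distribution function, its path is above `X` and is hit
later than `τ`, so the next iterate is below too. -/
lemma IsSolution.picard_le (h : IsSolution P α X₀ Z X τ Λ) (k : ℕ) (t : ℝ≥0) :
    picard P hα hX₀ hZ hZc k ((t : ℝ) : EReal) ≤ P.real {ω | τ ω ≤ t} := by
  induction k generalizing t with
  | zero =>
    have : picard P hα hX₀ hZ hZc 0 ((t : ℝ) : EReal) = 0 :=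
      zeroM_apply_of_ne_top (EReal.coe_ne_top _)
    rw [this]
    exact measureReal_nonneg
  | succ k ih =>
    rw [picard_succ, Gamma_apply_coe]
    refine measureReal_mono fun ω hω => le_trans ?_ (mem_ofPred_eq ▸ hω)
    rw [h.tau_eq]
    refine hitTime_mono fun s => ?_
    rw [h.X_eq, h.Lambda_eq]
    exact sub_le_sub_left (mul_le_mul_of_nonneg_left (ih s) hα.le) _

lemma IsSolution.picardLimit_le (h : IsSolution P α X₀ Z X τ Λ) (t : ℝ≥0) :
    α * picardLimit P hα hX₀ hZ hZc ((t : ℝ) : EReal) ≤ Λ t := by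
  rw [h.Lambda_eq]
  refine mul_le_mul_of_nonneg_left (le_measureReal_of_forall_gt P h.measurable_tau ?_) hα.le
  intro s hs
  refine (M.regularizedSup_le_iSup _ (EReal.coe_lt_coe_iff.mpr (NNReal.coe_lt_coe.mpr hs))).trans ?_
  exact ciSup_le fun k => h.picard_le P hα hX₀ hZ hZc k s

lemma isMinimalSolution_picardLimit (hcross : CrossingProperty P hX₀ hZ) :
    IsMinimalSolution P α X₀ Z (pathOf α X₀ Z (picardLimit P hα hX₀ hZ hZc))
      (tauOf α X₀ Z (picardLimit P hα hX₀ hZ hZc))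
      (fun t => α * picardLimit P hα hX₀ hZ hZc ((t : ℝ) : EReal)) where
  left :=
    { measurable_tau := measurable_tauOf hα hX₀ hZ hZc _
      X_eq := fun _ _ => rfl
      tau_eq := fun _ => rfl
      Lambda_eq := fun t => by rw [picardLimit_eq P hα hX₀ hZ hZc hcross] }
  right _ _ _ h := h.picardLimit_le P hα hX₀ hZ hZc

end PicardIteration

lemma IsMinimalSolution.unique {Ω : Type*} [MeasurableSpace Ω] {P : Measure Ω} {α : ℝ}
    {X₀ : Ω → ℝ} {Z : ℝ≥0 → Ω → ℝ} {X X' : ℝ≥0 → Ω → ℝ} {τ τ' : Ω → ℝ≥0∞} {Λ Λ' : ℝ≥0 → ℝ}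
    (h : IsMinimalSolution P α X₀ Z X τ Λ) (h' : IsMinimalSolution P α X₀ Z X' τ' Λ') :
    X' = X ∧ τ' = τ ∧ Λ' = Λ := by
  have hΛ : Λ' = Λ := funext fun t => le_antisymm (h'.2 _ _ _ h.1 t) (h.2 _ _ _ h'.1 t)
  have hX : X' = X := by
    ext t ω
    rw [h'.1.X_eq, h.1.X_eq, hΛ]
  refine ⟨hX, funext fun ω => ?_, hΛ⟩
  rw [h'.1.tau_eq, h.1.tau_eq, hX]

end McKeanVlasov

theorem theorem2p2 {Ω : Type*} [MeasurableSpace Ω] (P : Measure Ω) [IsProbabilityMeasure P]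
    {α : ℝ} (hα : 0 < α) {X₀ : Ω → ℝ} {Z : ℝ≥0 → Ω → ℝ}
    (hX₀ : Measurable X₀) (hZ : ∀ t, Measurable (Z t))
    (hZc : ∀ ω, Continuous fun t => Z t ω) (hZ₀ : ∀ ω, Z 0 ω = 0)
    (hindep : IndepFun X₀ (fun ω t => Z t ω) P)
    (hcross : McKeanVlasov.CrossingProperty P hX₀ hZ) :
    ∃ (X : ℝ≥0 → Ω → ℝ) (τ : Ω → ℝ≥0∞) (Λ : ℝ≥0 → ℝ),
      McKeanVlasov.IsMinimalSolution P α X₀ Z X τ Λ ∧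
      (∀ X' τ' Λ', McKeanVlasov.IsMinimalSolution P α X₀ Z X' τ' Λ' →
        X' = X ∧ τ' = τ ∧ Λ' = Λ) ∧
      ∃ l : McKeanVlasov.M, (∀ t : ℝ≥0, l ((t : ℝ) : EReal) = α⁻¹ * Λ t) ∧
        McKeanVlasov.ConvergesInM
          (fun k => (McKeanVlasov.Gamma P hα hX₀ hZ hZc)^[k] McKeanVlasov.zeroM) l := by
  refine ⟨_, _, _, McKeanVlasov.isMinimalSolution_picardLimit P hα hX₀ hZ hZc hcross,
    fun _ _ _ h => (McKeanVlasov.isMinimalSolution_picardLimit P hα hX₀ hZ hZc hcross).unique h,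
    McKeanVlasov.picardLimit P hα hX₀ hZ hZc, fun t => ?_, ?_⟩
  · rw [inv_mul_cancel_left₀ hα.ne']
  · exact McKeanVlasov.M.convergesInM_regularizedSup _
      (McKeanVlasov.picard_monotone P hα hX₀ hZ hZc)
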